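/- Let $F$ be a field of characteristic $0$ and let $z\in F^\times$ not be a root of unity (for example $F=\mathbb{Q}(z)$ with $z$ an indeterminate). Let $N,p\ge 0$ and $\zeta\ge 1$ be integers, let $x_1,\dots,x_p$ be indeterminates over $F$, and put $(a;q)_n=\prod_{m=0}^{n-1}(1-q^m a)$. In the field $F(x_1,\dots,x_p)$ define $$\mathcal{Z}_{N,p}=\sum_{\substack{k_1,\dots,k_p\ge 0\\ k_1+\dots+k_p=N}}\ \prod_{i=1}^p\bigl(x_i^{k_i}z^{k_i(k_i-1)/2}\bigr)^{\zeta}\prod_{i,j=1}^p\frac{1}{(z^{k_i-k_j+1}x_i/x_j;z)_{k_j}} .$$ Let $D_{1,\zeta}$ be the operator on $F(x_1,\dots,x_p)$ $$D_{1,\zeta}=\sum_{i=1}^p x_i^{\zeta}\prod_{j\neq i}\frac{1}{1-x_j/x_i}\,\Gamma_{z;i},$$ where $\Gamma_{z;i}$ substitutes $x_i\mapsto z x_i$ and fixes the other variables. Let $\Lambda_F=F[p_1,p_2,\dots]$ be the ring of symmetric functions over $F$, with $p_m$ the power sums. For a partition $\lambda$ let $Q_\lambda(X;z)\in\Lambda_F$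 be the Hall–Littlewood symmetric function: the element whose restriction to $n$ variables, for every $n\ge l(\lambda)$, is $$b_\lambda(z)\prod_{i\ge 0}\prod_{j=1}^{m_i(\lambda)}\frac{1-z}{1-z^j}\sum_{\sigma\in S_n}\sigma\Bigl(x_1^{\lambda_1}\cdots x_n^{\lambda_n}\prod_{i<j}\frac{1-z x_j/x_i}{1-x_j/x_i}\Bigr),\qquad b_\lambda(z)=\prod_{i\ge 1}(z;z)_{m_i(\lambda)},$$ where $m_i(\lambda)$ is the number of entries $i$ in $(\lambda_1,\dots,\lambda_n)$ (so $m_0(\lambda)=n-l(\lambda)$). The Milne (modified Hall–Littlewood) polynomial $Q'_\lambda(x_1,\dots,x_p;z)$ is the restriction to the variables $x_1,\dots,x_p$ of $Q_\lambda\bigl(\tfrac{X}{1-z};z\bigr)$, the image of $Q_\lambda(X;z)$ under $p_m\mapsto p_m/(1-z^m)$. Then, for the partition $(\zeta^N)$ with $N$ parts equal to $\zeta$, the symmetric function $Q_{(\zeta^N)}(X;z)$ exists and is unique, and $$\mathcal{Z}_{N,p}=\frac{1}{(z;z)_N}\,(D_{1,\zeta})^N\cdot 1=\frac{1}{(z;z)_N}\,Q'_{(\zeta^N)}(x_1,\dots,x_p;z).$$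 In particular $\mathcal{Z}_{N,p}$ is a polynomial in $x_1,\dots,x_p$. -/

import Mathlib

open MvPolynomial

noncomputable section

namespace HananyTong

/-- The finite `q`-Pochhammer symbol `(a; q)_n = ∏_{m=0}^{n-1} (1 - q^m a)`. -/
def qPoch {R : Type*} [CommRing R] (a q : R) (n : ℕ) : R :=
  ∏ m ∈ Finset.range n, (1 - q ^ m * a)

/-- The field `F(x_1, …, x_n)` of rational functions in `n` variables. -/
abbrev RatFun (F : Type*) [Field F] (n : ℕ) : Type _ :=
  FractionRing (MvPolynomial (Fin n) F)

section
variable {F : Type*} [Field F]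

/-- The variable `x_i`, as a rational function. -/
def xvar {n : ℕ} (i : Fin n) : RatFun F n :=
  algebraMap (MvPolynomial (Fin n) F) (RatFun F n) (X i)

/-- A scalar, as a constant rational function. -/
def const (n : ℕ) (c : F) : RatFun F n :=
  algebraMap (MvPolynomial (Fin n) F) (RatFun F n) (C c)

/-! ### The explicit sum -/

/-- `Z_{N,p} = ∑_{k_1+…+k_p=N} ∏_i (x_i^{k_i} z^{k_i(k_i-1)/2})^ζ
  ∏_{i,j} 1 / (z^{k_i-k_j+1} x_i/x_j; z)_{k_j}`. -/
def eulerSum (z : F) (N p ζ : ℕ) : RatFun F p :=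
  ∑ k ∈ Finset.piAntidiag (Finset.univ : Finset (Fin p)) N,
    (∏ i, (xvar i ^ k i * const p z ^ (k i * (k i - 1) / 2)) ^ ζ) *
      ∏ i, ∏ j, (qPoch (const p z ^ ((k i : ℤ) - (k j : ℤ) + 1) * (xvar i / xvar j))
        (const p z) (k j))⁻¹

/-! ### The raising operators -/

/-- The automorphism of the polynomial ring that multiplies the variables `x_i`, `i ∈ I`,
by `z` and fixes the other variables. -/
def shiftPoly {p : ℕ} (z : Fˣ) (I : Finset (Fin p)) :
    MvPolynomial (Fin p) F ≃ₐ[F] MvPolynomial (Fin p) F :=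
  AlgEquiv.ofAlgHom
    (aeval fun j => if j ∈ I then C (z : F) * X j else X j)
    (aeval fun j => if j ∈ I then C ((z⁻¹ : Fˣ) : F) * X j else X j)
    (by
      ext1 j
      by_cases h : j ∈ I
      · simp [h, algebraMap_eq, ← mul_assoc, ← C_mul]
      · simp [h])
    (by
      ext1 j
      by_cases h : j ∈ I
      · simp [h, algebraMap_eq, ← mul_assoc, ← C_mul]
      · simp [h])

/-- The shift operator `Γ_{z;I}` on rational functions: `x_i ↦ z x_i` for `i ∈ I`. -/
def shift {p : ℕ} (z : Fˣ) (I : Finset (Fin p)) : RatFun F p ≃+* RatFun F p :=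
  IsFractionRing.ringEquivOfRingEquiv (shiftPoly z I).toRingEquiv

/-- The raising operator
`D_{α,n} = ∑_{|I|=α} (∏_{i∈I} x_i)^n ∏_{i∈I, j∉I} 1/(1 - x_j/x_i) Γ_{z;I}`. -/
def raisingOp {p : ℕ} (z : Fˣ) (α n : ℕ) (f : RatFun F p) : RatFun F p :=
  ∑ I ∈ Finset.powersetCard α (Finset.univ : Finset (Fin p)),
    (∏ i ∈ I, xvar i) ^ n * (∏ i ∈ I, ∏ j ∈ Iᶜ, (1 - xvar j / xvar i)⁻¹) * shift z I f

/-! ### Hall–Littlewood and Milne polynomials -/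

/-- The rectangular partition `(ζ^N)`: `N` parts equal to `ζ`. -/
def rect (ζ N : ℕ) : YoungDiagram where
  cells := Finset.range N ×ˢ Finset.range ζ
  isLowerSet := by
    rintro ⟨a, b⟩ ⟨c, d⟩ ⟨h₁, h₂⟩ h
    simp only [Finset.coe_product, Finset.coe_range, Set.mem_prod, Set.mem_Iio] at h h₁ h₂ ⊢
    omega

/-- Arm length of the box in row `s.1` and column `s.2` (both counted from `0`). -/
def arm (μ : YoungDiagram) (s : ℕ × ℕ) : ℕ := μ.rowLen s.1 - (s.2 + 1)

/-- Leg length of the box in row `s.1` and column `s.2` (both counted from `0`). -/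
def leg (μ : YoungDiagram) (s : ℕ × ℕ) : ℕ := μ.colLen s.2 - (s.1 + 1)

/-- The Macdonald normalisation constant
`b_μ(q,t) = ∏_{s∈μ} (1 - q^{a(s)} t^{l(s)+1}) / (1 - q^{a(s)+1} t^{l(s)})`. -/
def bCoeff (μ : YoungDiagram) (q t : F) : F :=
  (∏ s ∈ μ.cells, (1 - q ^ arm μ s * t ^ (leg μ s + 1))) /
    ∏ s ∈ μ.cells, (1 - q ^ (arm μ s + 1) * t ^ leg μ s)

/-- The multiplicity `m_i` of `i` in `μ` padded with zeros to `(μ_1, …, μ_n)`. -/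
def mult (μ : YoungDiagram) (n i : ℕ) : ℕ :=
  ((Finset.range n).filter fun a => μ.rowLen a = i).card

/-- The Hall–Littlewood polynomial `P_μ(x_1, …, x_n; t)` (for `n` at least the length of `μ`):
`∏_{i≥0} ∏_{j=1}^{m_i} (1-t)/(1-t^j) *
  ∑_{σ∈S_n} σ (x_1^{μ_1} ⋯ x_n^{μ_n} ∏_{i<j} (1 - t x_j/x_i)/(1 - x_j/x_i))`. -/
def hallLittlewoodP (n : ℕ) (μ : YoungDiagram) (t : F) : RatFun F n :=
  const n (∏ i ∈ Finset.range (μ.rowLen 0 + 1), ∏ j ∈ Finset.Icc 1 (mult μ n i),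
      (1 - t) / (1 - t ^ j)) *
    ∑ σ : Equiv.Perm (Fin n),
      (∏ i : Fin n, xvar (σ i) ^ μ.rowLen i) *
        ∏ i : Fin n, ∏ j ∈ Finset.Ioi i,
          (1 - const n t * (xvar (σ j) / xvar (σ i))) / (1 - xvar (σ j) / xvar (σ i))

/-- `Q_μ(x_1, …, x_n; t) = b_μ(0,t) P_μ(x_1, …, x_n; t)`. -/
def hallLittlewoodQ (n : ℕ) (μ : YoungDiagram) (t : F) : RatFun F n :=
  const n (bCoeff μ 0 t) * hallLittlewoodP n μ t

/-- The ring `Λ_F` of symmetric functions over a field of characteristic zero, as the polynomial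
ring in the power sums `p_1, p_2, …`. -/
abbrev SymFun (F : Type*) [Field F] : Type _ := MvPolynomial ℕ+ F

/-- Restriction of a symmetric function to `n` variables: `p_m ↦ x_1^m + ⋯ + x_n^m`. -/
def toVars (n : ℕ) : SymFun F →ₐ[F] MvPolynomial (Fin n) F :=
  aeval fun m : ℕ+ => psum (Fin n) F (m : ℕ)

/-- The plethystic substitution `f(X) ↦ f(X/(1-t))`: `p_m ↦ p_m / (1 - t^m)`. -/
def plethysm (t : F) : SymFun F →ₐ[F] SymFun F :=
  aeval fun m : ℕ+ => C ((1 - t ^ (m : ℕ))⁻¹) * X m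

/-- `f` is the Hall–Littlewood symmetric function `Q_μ(X; t)`: in every number `n ≥ l(μ)` of
variables it restricts to `Q_μ(x_1, …, x_n; t)`. -/
def IsHallLittlewoodQ (μ : YoungDiagram) (t : F) (f : SymFun F) : Prop :=
  ∀ n : ℕ, μ.colLen 0 ≤ n →
    algebraMap (MvPolynomial (Fin n) F) (RatFun F n) (toVars n f) = hallLittlewoodQ n μ t

/-- The Hall–Littlewood symmetric function `Q_μ(X; t)`. -/
def hallLittlewoodSymQ (μ : YoungDiagram) (t : F) : SymFun F :=
  Classical.epsilon (IsHallLittlewoodQ μ t)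

/-- The Milne (modified Hall–Littlewood) polynomial `Q'_μ(x_1, …, x_p; t)`: the restriction to
`p` variables of `Q_μ(X/(1-t); t)`. -/
def milne (p : ℕ) (μ : YoungDiagram) (t : F) : MvPolynomial (Fin p) F :=
  toVars p (plethysm t (hallLittlewoodSymQ μ t))

end

end HananyTong

end

namespace HananyTong

open Finset

section PartialFractions

variable {K : Type*} [Field K] {n : ℕ}

/-- The residue of `∏_j (1 - a_j u) / (1 - v_j u)` at `u = 1 / v_i`: the coefficient of
`1 / (1 - v_i u)` in its partial fraction expansion. -/
noncomputable def weight (v a : Fin n → K) (i : Fin n) : K :=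
  (∏ j, (1 - a j / v i)) * ∏ j ∈ ({i} : Finset (Fin n))ᶜ, (1 - v j / v i)⁻¹

theorem natDegree_prod_one_sub_le (s : Finset (Fin n)) (a : Fin n → K) :
    (∏ j ∈ s, (1 - Polynomial.C (a j) * Polynomial.X)).natDegree ≤ #s := by
  refine (Polynomial.natDegree_prod_le _ _).trans ?_
  calc _ ≤ ∑ _j ∈ s, 1 := Finset.sum_le_sum fun j _ => by compute_degree
    _ = #s := by simp

theorem prod_one_sub_eq (v a : Fin n → K) (hv : Function.Injective v) (h0 : ∀ i, v i ≠ 0) :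
    ∏ j, (1 - Polynomial.C (a j) * Polynomial.X) =
      ∏ j, (1 - Polynomial.C (v j) * Polynomial.X) +
        ∑ i, Polynomial.C (weight v a i * v i) * Polynomial.X *
          ∏ j ∈ ({i} : Finset (Fin n))ᶜ, (1 - Polynomial.C (v j) * Polynomial.X) := by
  classical
  have hinj : Function.Injective fun i => (v i)⁻¹ := fun i j h => hv (inv_injective h)
  have hcard : #(insert (0 : K) (univ.image fun i => (v i)⁻¹)) = n + 1 := by
    rw [card_insert_of_notMem (by simp [h0]), card_image_of_injective _ hinj]
    simp
  refine Polynomial.eq_of_degree_sub_lt_of_eval_finset_eq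
    (insert 0 (univ.image fun i => (v i)⁻¹)) ?_ ?_
  · rw [hcard]
    refine lt_of_le_of_lt (b := (n : WithBot ℕ)) ?_ (by exact_mod_cast Nat.lt_succ_self n)
    have h1 (b : Fin n → K) :
        (∏ j, (1 - Polynomial.C (b j) * Polynomial.X)).degree ≤ (n : WithBot ℕ) :=
      Polynomial.degree_le_of_natDegree_le
        ((natDegree_prod_one_sub_le univ b).trans (by simp))
    refine (Polynomial.degree_sub_le _ _).trans (max_le (h1 a)
      ((Polynomial.degree_add_le _ _).trans (max_le (h1 v) ?_)))
    refine (Polynomial.degree_sum_le _ _).trans (Finset.sup_le fun i _ => ?_)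
    refine Polynomial.degree_le_of_natDegree_le (Polynomial.natDegree_mul_le.trans ?_)
    have h2 := natDegree_prod_one_sub_le ({i}ᶜ) v
    have h3 : (Polynomial.C (weight v a i * v i) * Polynomial.X).natDegree ≤ 1 := by
      compute_degree
    rw [card_compl, card_singleton, Fintype.card_fin] at h2
    have := i.pos
    omega
  · intro x hx
    rw [mem_insert, mem_image] at hx
    rcases hx with rfl | ⟨k, -, rfl⟩
    · simp [Polynomial.eval_prod, Polynomial.eval_finsetSum]
    · simp only [Polynomial.eval_prod, Polynomial.eval_finsetSum, Polynomial.eval_sub,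
        Polynomial.eval_one, Polynomial.eval_mul, Polynomial.eval_C, Polynomial.eval_X,
        Polynomial.eval_add]
      rw [Finset.prod_eq_zero (s := univ) (i := k) (f := fun j => 1 - v j * (v k)⁻¹)
        (mem_univ k) (by simp [h0]), zero_add, Finset.sum_eq_single k]
      · have hne : ∏ j ∈ ({k} : Finset (Fin n))ᶜ, (1 - v j * (v k)⁻¹) ≠ 0 := by
          refine Finset.prod_ne_zero_iff.2 fun j hj h => ?_
          simp only [mem_compl, mem_singleton] at hj
          exact hj (hv ((mul_inv_eq_one₀ (h0 k)).1 (sub_eq_zero.1 h).symm))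
        simp only [weight, div_eq_mul_inv, Finset.prod_inv_distrib]
        rw [mul_assoc _ (v k), mul_inv_cancel₀ (h0 k), mul_one, inv_mul_cancel_right₀ hne]
      · intro i _ hik
        rw [Finset.prod_eq_zero (i := k) (by simpa using Ne.symm hik) (by simp [h0]), mul_zero]
      · simp

theorem sum_weight (v a : Fin n → K) (hv : Function.Injective v) (h0 : ∀ i, v i ≠ 0) :
    ∑ i, weight v a i = 1 - ∏ i, a i / v i := by
  have key (s : Finset (Fin n)) (b : Fin n → K) :
      (∏ j ∈ s, (1 - Polynomial.C (b j) * Polynomial.X)).coeff #s = ∏ j ∈ s, (- b j) := by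
    have := Polynomial.coeff_prod_of_natDegree_le s
      (fun j => 1 - Polynomial.C (b j) * Polynomial.X) 1 (fun j _ => by compute_degree)
    rw [mul_one] at this
    rw [this]
    refine Finset.prod_congr rfl fun j _ => ?_
    simp [Polynomial.coeff_one]
  have h := congrArg (fun f => Polynomial.coeff f #(univ : Finset (Fin n)))
    (prod_one_sub_eq v a hv h0)
  simp only [Polynomial.coeff_add, Polynomial.finsetSum_coeff, key] at h
  have hprod : ∏ j, (- v j) ≠ 0 := Finset.prod_ne_zero_iff.2 fun j _ => neg_ne_zero.2 (h0 j)
  have hterm (i : Fin n) : (Polynomial.C (weight v a i * v i) * Polynomial.X *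
      ∏ j ∈ ({i} : Finset (Fin n))ᶜ, (1 - Polynomial.C (v j) * Polynomial.X)).coeff
        #(univ : Finset (Fin n)) = - (weight v a i * ∏ j, (- v j)) := by
    have hc : #(univ : Finset (Fin n)) = #(({i} : Finset (Fin n))ᶜ) + 1 := by
      have := i.pos
      rw [card_compl, card_singleton, card_univ, Fintype.card_fin]
      omega
    rw [hc, mul_assoc, Polynomial.coeff_C_mul, Polynomial.coeff_X_mul, key,
      ← Finset.prod_mul_prod_compl {i}, prod_singleton]
    ring
  simp only [hterm, Finset.sum_neg_distrib, ← Finset.sum_mul] at h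
  have h' : ∏ i, a i / v i = (∏ j, (- a j)) / ∏ j, (- v j) := by
    rw [← Finset.prod_div_distrib]
    exact Finset.prod_congr rfl fun j _ => by rw [neg_div_neg_eq]
  rw [h', h]
  field_simp
  ring

end PartialFractions

section Newton

variable {K : Type*} [Field K] {n : ℕ}

theorem mk_pow_mul_one_sub (x : K) :
    PowerSeries.mk (fun r => x ^ r) * (1 - PowerSeries.C x * PowerSeries.X) = 1 := by
  ext r
  rw [mul_sub, mul_one, mul_left_comm, map_sub, PowerSeries.coeff_C_mul]
  cases r with
  | zero => simp
  | succ r => simp [PowerSeries.coeff_one, pow_succ, mul_comm]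

theorem derivative_prod_one_sub (s : Finset (Fin n)) (x : Fin n → K) :
    PowerSeries.derivative K (∏ i ∈ s, (1 - PowerSeries.C (x i) * PowerSeries.X)) =
      - ((∏ i ∈ s, (1 - PowerSeries.C (x i) * PowerSeries.X)) *
        ∑ i ∈ s, PowerSeries.C (x i) * PowerSeries.mk (fun r => x i ^ r)) := by
  classical
  induction s using Finset.induction_on with
  | empty => simp
  | insert i s hi ih =>
    have hd : PowerSeries.derivative K (1 - PowerSeries.C (x i) * PowerSeries.X)
        = - PowerSeries.C (x i) := by
      rw [map_sub, Derivation.leibniz, PowerSeries.derivative_C, PowerSeries.derivative_X]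
      simp
    rw [Finset.prod_insert hi, Finset.sum_insert hi, Derivation.leibniz, ih, hd]
    simp only [smul_eq_mul]
    linear_combination (PowerSeries.C (x i) * ∏ i ∈ s, (1 - PowerSeries.C (x i) * PowerSeries.X))
      * mk_pow_mul_one_sub (x i)

/-- The Taylor coefficients of `∏_j (1 - a_j u) / (1 - v_j u)`. -/
noncomputable def taylorCoeff (v a : Fin n → K) (r : ℕ) : K :=
  if r = 0 then 1 else ∑ i, weight v a i * v i ^ r

theorem mk_taylorCoeff_mul (v a : Fin n → K) (hv : Function.Injective v) (h0 : ∀ i, v i ≠ 0) :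
    PowerSeries.mk (taylorCoeff v a) * ∏ i, (1 - PowerSeries.C (v i) * PowerSeries.X) =
      ∏ i, (1 - PowerSeries.C (a i) * PowerSeries.X) := by
  have h := congrArg (fun f : Polynomial K => (f : PowerSeries K)) (prod_one_sub_eq v a hv h0)
  simp only [← Polynomial.coeToPowerSeries.ringHom_apply, map_add, map_sum, map_prod, map_mul,
    map_sub, map_one] at h
  simp only [Polynomial.coeToPowerSeries.ringHom_apply, Polynomial.coe_C, Polynomial.coe_X] at h
  have hmk : PowerSeries.mk (taylorCoeff v a) = 1 + ∑ i, PowerSeries.C (weight v a i) *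
      (PowerSeries.C (v i) * PowerSeries.X * PowerSeries.mk (fun r => v i ^ r)) := by
    ext r
    simp only [map_add, map_sum, PowerSeries.coeff_C_mul, mul_assoc, PowerSeries.coeff_mk]
    cases r with
    | zero => simp [taylorCoeff]
    | succ r => simp [taylorCoeff, PowerSeries.coeff_succ_X_mul, PowerSeries.coeff_one, pow_succ,
        mul_comm]
  rw [h, hmk, add_mul, one_mul, Finset.sum_mul]
  congr 1
  refine Finset.sum_congr rfl fun i _ => ?_
  rw [← Finset.prod_mul_prod_compl {i}, prod_singleton]
  linear_combination (PowerSeries.C (weight v a i) * PowerSeries.C (v i) * PowerSeries.X *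
    ∏ j ∈ ({i} : Finset (Fin n))ᶜ, (1 - PowerSeries.C (v j) * PowerSeries.X)) *
      mk_pow_mul_one_sub (v i)

theorem taylorCoeff_succ (v a : Fin n → K) (hv : Function.Injective v) (h0 : ∀ i, v i ≠ 0)
    (r : ℕ) :
    ((r : K) + 1) * taylorCoeff v a (r + 1) =
      ∑ m ∈ range (r + 1), (∑ i, (v i ^ (m + 1) - a i ^ (m + 1))) * taylorCoeff v a (r - m) := by
  set G := PowerSeries.mk (taylorCoeff v a) with hG
  set V := ∏ i, (1 - PowerSeries.C (v i) * PowerSeries.X) with hV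
  have hGV := mk_taylorCoeff_mul v a hv h0
  rw [← hG, ← hV] at hGV
  have hV0 : V ≠ 0 := by
    refine Finset.prod_ne_zero_iff.2 fun i _ h => ?_
    have := congrArg PowerSeries.constantCoeff h
    simp at this
  have hd := congrArg (PowerSeries.derivative K) hGV
  rw [derivative_prod_one_sub, Derivation.leibniz, hV, derivative_prod_one_sub, ← hV,
    ← hGV] at hd
  simp only [smul_eq_mul] at hd
  have key : PowerSeries.derivative K G =
      (∑ i, PowerSeries.C (v i) * PowerSeries.mk (fun r => v i ^ r) -
        ∑ i, PowerSeries.C (a i) * PowerSeries.mk (fun r => a i ^ r)) * G := by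
    apply mul_left_cancel₀ hV0
    linear_combination hd
  have hc := congrArg (PowerSeries.coeff r) key
  rw [PowerSeries.coeff_derivative, hG, PowerSeries.coeff_mk, PowerSeries.coeff_mul,
    Finset.Nat.sum_antidiagonal_eq_sum_range_succ_mk] at hc
  rw [mul_comm, hc]
  refine Finset.sum_congr rfl fun m _ => ?_
  simp [pow_succ, mul_comm, Finset.sum_sub_distrib]

end Newton

section VertexOperator

variable {F : Type*} [Field F]

/-- The symmetric functions `q_r(X; t)`, with generating function
`∑_r q_r u^r = ∏_i (1 - t x_i u) / (1 - x_i u)`, in terms of the power sums. -/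
noncomputable def qSym (t : F) : ℕ → SymFun F
  | 0 => 1
  | r + 1 => C ((r : F) + 1)⁻¹ *
      ∑ m : Fin (r + 1), C (1 - t ^ (m + 1 : ℕ)) * X (Nat.succPNat m) * qSym t (r - m)

/-- The translation `f[X] ↦ f[X - y]`, that is `p_m ↦ p_m - y^m`. -/
noncomputable def translate : SymFun F →ₐ[F] Polynomial (SymFun F) :=
  aeval fun m : ℕ+ => Polynomial.C (X m) - Polynomial.X ^ (m : ℕ)

/-- The vertex operator that adds a part `s` to a Hall–Littlewood function: the coefficient of
`u^s` in `(∑_r q_r u^r) f[X - 1/u]`. -/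
noncomputable def vertexOp (t : F) (s : ℕ) (f : SymFun F) : SymFun F :=
  (translate f).sum fun k c => c * qSym t (s + k)

variable {K : Type*} [Field K] [Algebra F K] {n : ℕ}

theorem map_qSym [CharZero F] (t : F) (ε : SymFun F →ₐ[F] K) (v a : Fin n → K)
    (hv : Function.Injective v) (h0 : ∀ i, v i ≠ 0)
    (hε : ∀ m : ℕ+, algebraMap F K (1 - t ^ (m : ℕ)) * ε (X m) =
      ∑ i, (v i ^ (m : ℕ) - a i ^ (m : ℕ))) (r : ℕ) :
    ε (qSym t r) = taylorCoeff v a r := by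
  induction r using Nat.strong_induction_on with
  | _ r ih =>
    cases r with
    | zero => simp [qSym, taylorCoeff]
    | succ r =>
      have hr : (r : K) + 1 ≠ 0 := by
        have : (algebraMap F K) ((r : F) + 1) ≠ 0 :=
          (map_ne_zero _).2 (by exact_mod_cast Nat.succ_ne_zero r)
        simpa using this
      apply mul_left_cancel₀ hr
      rw [taylorCoeff_succ v a hv h0, qSym, Finset.sum_range, map_mul, map_sum,
        ← algebraMap_eq, AlgHom.commutes, map_inv₀, map_add, map_natCast, map_one,
        mul_inv_cancel_left₀ hr]
      refine Finset.sum_congr rfl fun m _ => ?_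
      have h1 := hε (Nat.succPNat m)
      rw [Nat.succPNat_coe, Nat.succ_eq_add_one] at h1
      rw [map_mul, map_mul, AlgHom.commutes, h1, ih _ (by omega)]

theorem map_vertexOp [CharZero F] (t : F) (ε : SymFun F →ₐ[F] K) (v a : Fin n → K)
    (hv : Function.Injective v) (h0 : ∀ i, v i ≠ 0)
    (hε : ∀ m : ℕ+, algebraMap F K (1 - t ^ (m : ℕ)) * ε (X m) =
      ∑ i, (v i ^ (m : ℕ) - a i ^ (m : ℕ))) (s : ℕ) (hs : 0 < s) (f : SymFun F) :
    ε (vertexOp t s f) = ∑ i, weight v a i * v i ^ s *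
      aeval (fun m : ℕ+ => ε (X m) - v i ^ (m : ℕ)) f := by
  have htr (i : Fin n) : aeval (fun m : ℕ+ => ε (X m) - v i ^ (m : ℕ)) f =
      (translate f).eval₂ (ε : SymFun F →+* K) (v i) := by
    have : ((aeval (fun m : ℕ+ => ε (X m) - v i ^ (m : ℕ)) : SymFun F →ₐ[F] K) :
        SymFun F →+* K) = (Polynomial.eval₂RingHom (ε : SymFun F →+* K) (v i)).comp
          (translate : SymFun F →ₐ[F] Polynomial (SymFun F)) := by
      refine MvPolynomial.ringHom_ext (fun c => ?_) fun m => ?_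
      · simp [← algebraMap_eq, Polynomial.algebraMap_apply]
      · simp [translate]
    exact congrArg (fun g : SymFun F →+* K => g f) this
  simp only [htr, Polynomial.eval₂_eq_sum, vertexOp, Polynomial.sum, map_sum, map_mul,
    Finset.mul_sum]
  rw [Finset.sum_comm]
  refine Finset.sum_congr rfl fun k _ => ?_
  rw [map_qSym t ε v a hv h0 hε, taylorCoeff, if_neg (by omega), Finset.mul_sum]
  refine Finset.sum_congr rfl fun i _ => ?_
  rw [RingHom.coe_coe, pow_add]
  ring

end VertexOperator

section Symmetrization

variable {K : Type*} [Field K]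

/-- `∑_σ σ (x_1^{e_1} ⋯ x_n^{e_n} ∏_{i<j} (1 - t x_j/x_i)/(1 - x_j/x_i))` at the point `v`. -/
noncomputable def symmSum {n : ℕ} (t : K) (e : Fin n → ℕ) (v : Fin n → K) : K :=
  ∑ σ : Equiv.Perm (Fin n), (∏ i, v (σ i) ^ e i) *
    ∏ i : Fin n, ∏ j ∈ Finset.Ioi i, (1 - t * (v (σ j) / v (σ i))) / (1 - v (σ j) / v (σ i))

/-- An enumeration of the indices different from `p`. -/
def skipIndex {n : ℕ} (p : Fin (n + 1)) (k : Fin n) : Fin (n + 1) := Equiv.swap 0 p k.succ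

theorem skipIndex_injective {n : ℕ} (p : Fin (n + 1)) : Function.Injective (skipIndex p) :=
  (Equiv.injective _).comp (Fin.succ_injective n)

theorem map_skipIndex {n : ℕ} (p : Fin (n + 1)) :
    univ.map ⟨skipIndex p, skipIndex_injective p⟩ = ({p} : Finset (Fin (n + 1)))ᶜ := by
  refine Finset.eq_of_subset_of_card_le (fun j hj => ?_) ?_
  · simp only [mem_map, mem_univ, true_and, Function.Embedding.coeFn_mk] at hj
    obtain ⟨k, rfl⟩ := hj
    simp only [mem_compl, mem_singleton]
    intro h
    rw [skipIndex, Equiv.swap_apply_eq_iff, Equiv.swap_apply_right] at h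
    exact Fin.succ_ne_zero k h
  · simp [card_compl]

theorem prod_skipIndex {n : ℕ} (p : Fin (n + 1)) (g : Fin (n + 1) → K) :
    ∏ k, g (skipIndex p k) = ∏ j ∈ ({p} : Finset (Fin (n + 1)))ᶜ, g j := by
  rw [← map_skipIndex, Finset.prod_map]
  rfl

theorem sum_skipIndex {n : ℕ} (p : Fin (n + 1)) (g : Fin (n + 1) → K) :
    ∑ k, g (skipIndex p k) = ∑ j, g j - g p := by
  rw [← Finset.sum_add_sum_compl {p} g, ← map_skipIndex, Finset.sum_map]
  simp

theorem weight_mul_self {n : ℕ} (t : K) (v : Fin n → K) (h0 : ∀ i, v i ≠ 0) (p : Fin n) :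
    weight v (fun j => t * v j) p = (1 - t) *
      ∏ j ∈ ({p} : Finset (Fin n))ᶜ, (1 - t * (v j / v p)) / (1 - v j / v p) := by
  rw [weight, ← Finset.prod_mul_prod_compl {p}, prod_singleton, mul_div_cancel_right₀ _ (h0 p),
    mul_assoc, ← Finset.prod_mul_distrib]
  simp only [div_eq_mul_inv, mul_assoc]

theorem symmSum_succ {n : ℕ} (t : K) (e : Fin (n + 1) → ℕ) (v : Fin (n + 1) → K)
    (h0 : ∀ i, v i ≠ 0) :
    (1 - t) * symmSum t e v = ∑ p, weight v (fun j => t * v j) p * v p ^ e 0 *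
      symmSum t (fun k => e k.succ) (fun k => v (skipIndex p k)) := by
  rw [symmSum, ← Equiv.Perm.decomposeFin.symm.sum_comp, Fintype.sum_prod_type, Finset.mul_sum]
  refine Finset.sum_congr rfl fun p _ => ?_
  rw [symmSum, Finset.mul_sum, Finset.mul_sum]
  refine Finset.sum_congr rfl fun σ _ => ?_
  have hIoi : Finset.Ioi (0 : Fin (n + 1)) = univ.map (Fin.succEmb n) := by
    ext j
    cases j using Fin.cases <;> simp
  have hσ : ∏ k, (1 - t * (v (skipIndex p (σ k)) / v p)) / (1 - v (skipIndex p (σ k)) / v p) =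
      ∏ j ∈ ({p} : Finset (Fin (n + 1)))ᶜ, (1 - t * (v j / v p)) / (1 - v j / v p) := by
    rw [Equiv.prod_comp σ fun k => (1 - t * (v (skipIndex p k) / v p)) / (1 - v (skipIndex p k) / v p),
      prod_skipIndex p fun j => (1 - t * (v j / v p)) / (1 - v j / v p)]
  rw [Fin.prod_univ_succ, Fin.prod_univ_succ, hIoi, Finset.prod_map, weight_mul_self t v h0, ← hσ]
  simp only [Equiv.Perm.decomposeFin_symm_apply_zero, Equiv.Perm.decomposeFin_symm_apply_succ,
    Fin.coe_succEmb, ← skipIndex.eq_1, ← Fin.map_succEmb_Ioi, Finset.prod_map]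
  ring

theorem qPoch_succ (a q : K) (n : ℕ) :
    qPoch a q (n + 1) = qPoch a q n * (1 - q ^ n * a) := by
  rw [qPoch, Finset.prod_range_succ, qPoch]

theorem symmSum_zero {n : ℕ} (t : K) (v : Fin n → K) (hv : Function.Injective v)
    (h0 : ∀ i, v i ≠ 0) :
    (1 - t) ^ n * symmSum t (fun _ => 0) v = qPoch t t n := by
  induction n with
  | zero => simp [symmSum, qPoch]
  | succ n ih =>
    rw [pow_succ, mul_assoc, symmSum_succ t _ v h0, Finset.mul_sum, qPoch_succ, ← pow_succ]
    have hw := sum_weight v (fun j => t * v j) hv h0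
    simp only [mul_div_cancel_right₀ t (h0 _), prod_const, card_univ, Fintype.card_fin] at hw
    rw [← hw, Finset.mul_sum]
    refine Finset.sum_congr rfl fun p _ => ?_
    rw [← ih (fun k => v (skipIndex p k)) (hv.comp (skipIndex_injective p)) fun k => h0 _]
    ring

variable {F : Type*} [Field F] [CharZero F] [Algebra F K]

theorem aeval_vertexOp_iterate (t : F) (s : ℕ) (hs : 0 < s) (N : ℕ) {n : ℕ} (hn : N ≤ n)
    (v : Fin n → K) (hv : Function.Injective v) (h0 : ∀ i, v i ≠ 0) :
    qPoch (algebraMap F K t) (algebraMap F K t) (n - N) *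
        aeval (fun m : ℕ+ => ∑ i, v i ^ (m : ℕ)) ((vertexOp t s)^[N] 1) =
      (1 - algebraMap F K t) ^ n *
        symmSum (algebraMap F K t) (fun i => if (i : ℕ) < N then s else 0) v := by
  induction N generalizing n with
  | zero => simp [symmSum_zero _ v hv h0]
  | succ N ih =>
    obtain ⟨n, rfl⟩ : ∃ k, n = k + 1 := ⟨n - 1, by omega⟩
    rw [Function.iterate_succ_apply', map_vertexOp t _ v (fun j => algebraMap F K t * v j) hv h0
      _ s hs, pow_succ, mul_assoc, symmSum_succ _ _ _ h0, Finset.mul_sum, Finset.mul_sum]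
    · refine Finset.sum_congr rfl fun p _ => ?_
      have := ih (n := n) (by omega) (fun k => v (skipIndex p k)) (hv.comp (skipIndex_injective p))
        (fun k => h0 _)
      have hsk : (fun m : ℕ+ => ∑ k, v (skipIndex p k) ^ (m : ℕ)) =
          fun m : ℕ+ => ∑ j, v j ^ (m : ℕ) - v p ^ (m : ℕ) :=
        funext fun m => sum_skipIndex p fun j => v j ^ (m : ℕ)
      rw [hsk] at this
      simp only [aeval_X, Fin.val_zero, Nat.succ_pos, if_true, Fin.val_succ,
        Nat.add_lt_add_iff_right, Nat.add_sub_add_right]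
      linear_combination (weight v (fun j => algebraMap F K t * v j) p * v p ^ s) * this
    · intro m
      simp only [aeval_X, map_sub, map_one, map_pow, Finset.mul_sum, mul_pow]
      exact Finset.sum_congr rfl fun i _ => by ring

end Symmetrization

section PowerSums

theorem injective_of_surjective_ringEnd {R : Type*} [CommRing R] [IsNoetherianRing R]
    (f : R →+* R) (hf : Function.Surjective f) : Function.Injective f := by
  let I : ℕ →o Ideal R :=
    { toFun := fun n => RingHom.ker (f ^ n)
      monotone' := monotone_nat_of_le_succ fun n x hx => by
        rw [RingHom.mem_ker] at hx ⊢
        rw [pow_succ', RingHom.mul_def, RingHom.comp_apply, hx, map_zero] }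
  obtain ⟨n, hn⟩ := monotone_stabilizes_iff_noetherian.2 ‹IsNoetherianRing R› I
  rw [injective_iff_map_eq_zero]
  intro x hx
  have hfn : Function.Surjective (f ^ n) := by
    rw [RingHom.coe_pow]
    exact hf.iterate n
  obtain ⟨y, rfl⟩ := hfn x
  have hy : y ∈ I (n + 1) := by
    change y ∈ RingHom.ker (f ^ (n + 1))
    rw [RingHom.mem_ker, pow_succ', RingHom.mul_def, RingHom.comp_apply, hx]
  rw [← hn (n + 1) n.le_succ] at hy
  exact hy

variable {F : Type*} [Field F] [CharZero F]

theorem esymm_mem_adjoin_psum (n k : ℕ) (hk : k ≤ n) :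
    esymm (Fin n) F k ∈ (aeval fun i : Fin n => psum (Fin n) F (i + 1) :
      MvPolynomial (Fin n) F →ₐ[F] MvPolynomial (Fin n) F).range := by
  induction k using Nat.strong_induction_on with
  | _ k ih =>
    set S := (aeval fun i : Fin n => psum (Fin n) F (i + 1) :
      MvPolynomial (Fin n) F →ₐ[F] MvPolynomial (Fin n) F).range
    obtain rfl | hpos := Nat.eq_zero_or_pos k
    · rw [esymm_zero]
      exact S.one_mem
    · have hk0 : (k : F) ≠ 0 := by exact_mod_cast hpos.ne'
      have h : esymm (Fin n) F k = (k : F)⁻¹ • ((k : MvPolynomial (Fin n) F) *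
          esymm (Fin n) F k) := by
        rw [smul_eq_C_mul, ← mul_assoc, ← map_natCast C k, ← C_mul, inv_mul_cancel₀ hk0, C_1,
          one_mul]
      rw [h, mul_esymm_eq_sum]
      have hneg (j : ℕ) : (-1 : MvPolynomial (Fin n) F) ^ j ∈ S :=
        S.pow_mem (S.neg_mem S.one_mem) j
      refine S.smul_mem (S.mul_mem (hneg _) (S.sum_mem fun a ha => ?_)) _
      rw [mem_filter, HasAntidiagonal.mem_antidiagonal] at ha
      refine S.mul_mem (S.mul_mem (hneg _) (ih _ ha.2 (by omega))) ?_
      refine ⟨X ⟨a.2 - 1, by omega⟩, ?_⟩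
      rw [AlgHom.toRingHom_eq_coe, RingHom.coe_coe, aeval_X]
      congr
      simp only
      omega

theorem aeval_psum_injective (n : ℕ) :
    Function.Injective (aeval fun i : Fin n => psum (Fin n) F (i + 1) :
      MvPolynomial (Fin n) F →ₐ[F] MvPolynomial (Fin n) F) := by
  set ψ := (aeval fun i : Fin n => psum (Fin n) F (i + 1) :
      MvPolynomial (Fin n) F →ₐ[F] MvPolynomial (Fin n) F) with hψ
  have hsymm (f : MvPolynomial (Fin n) F) : ψ f ∈ symmetricSubalgebra (Fin n) F := by
    have hle : Algebra.adjoin F (Set.range fun i : Fin n => psum (Fin n) F (i + 1)) ≤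
        symmetricSubalgebra (Fin n) F := by
      rw [Algebra.adjoin_le_iff]
      rintro _ ⟨i, rfl⟩
      exact psum_isSymmetric (Fin n) F _
    apply hle
    rw [Algebra.adjoin_range_eq_range_aeval]
    exact ⟨f, rfl⟩
  let χ : MvPolynomial (Fin n) F →ₐ[F] symmetricSubalgebra (Fin n) F :=
    ψ.codRestrict _ hsymm
  let e := esymmAlgEquiv (Fin n) F (Fintype.card_fin n)
  have hχ : Function.Surjective χ := by
    intro y
    obtain ⟨g, rfl⟩ := e.surjective y
    have hmem : ((e g : symmetricSubalgebra (Fin n) F) : MvPolynomial (Fin n) F) ∈ ψ.range := by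
      change (esymmAlgHom (Fin n) F n g).val ∈ _
      rw [esymmAlgHom_apply]
      have hle : Algebra.adjoin F (Set.range fun i : Fin n => esymm (Fin n) F (i + 1)) ≤
          ψ.range := by
        rw [Algebra.adjoin_le_iff]
        rintro _ ⟨i, rfl⟩
        exact esymm_mem_adjoin_psum n (i + 1) i.2
      apply hle
      rw [Algebra.adjoin_range_eq_range_aeval]
      exact ⟨g, rfl⟩
    obtain ⟨f, hf⟩ := hmem
    exact ⟨f, Subtype.ext hf⟩
  have hinj := injective_of_surjective_ringEnd
    ((e.symm : symmetricSubalgebra (Fin n) F →+* MvPolynomial (Fin n) F).comp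
      (χ : MvPolynomial (Fin n) F →+* symmetricSubalgebra (Fin n) F))
    (e.symm.surjective.comp hχ)
  intro f g hfg
  apply hinj
  have : χ f = χ g := Subtype.ext hfg
  simp [this]

/-- A symmetric function is determined by its restrictions to large numbers of variables. -/
theorem eq_of_toVars_eq (N : ℕ) (f g : SymFun F) (h : ∀ n, N ≤ n → toVars n f = toVars n g) :
    f = g := by
  classical
  rw [← sub_eq_zero]
  set d := f - g with hd
  have hd0 (n : ℕ) (hn : N ≤ n) : toVars n d = 0 := by rw [hd, map_sub, h n hn, sub_self]
  let n := N + d.vars.sup fun m : ℕ+ => (m : ℕ)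
  let ι : Fin n → ℕ+ := fun i => Nat.succPNat i
  have hι : Function.Injective ι := fun i j hij => by
    have := congrArg PNat.val hij
    simpa [ι, Fin.ext_iff] using this
  obtain ⟨d', hd'⟩ : ∃ d', rename ι d' = d := by
    refine exists_rename_eq_of_vars_subset_range d ι hι fun m hm => ?_
    have hle : (m : ℕ) ≤ d.vars.sup fun m : ℕ+ => (m : ℕ) :=
      Finset.le_sup (f := fun m : ℕ+ => (m : ℕ)) hm
    have := m.pos
    exact ⟨⟨m.natPred, by rw [PNat.natPred]; omega⟩, by simp [ι]⟩
  have h1 := hd0 n (by omega)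
  rw [← hd', toVars, aeval_rename] at h1
  have h2 : d' = 0 := aeval_psum_injective n (by rw [map_zero]; exact h1)
  rw [← hd', h2, map_zero]

end PowerSums

section Rectangle

variable {F : Type*} [Field F]

theorem mem_rect {ζ N i j : ℕ} : (i, j) ∈ rect ζ N ↔ i < N ∧ j < ζ := by
  rw [← YoungDiagram.mem_cells]
  simp [rect]

theorem rowLen_rect (ζ N i : ℕ) : (rect ζ N).rowLen i = if i < N then ζ else 0 := by
  refine eq_of_forall_lt_iff fun j => ?_
  rw [← YoungDiagram.mem_iff_lt_rowLen, mem_rect]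
  split_ifs <;> simp [*]

theorem colLen_rect (ζ N j : ℕ) : (rect ζ N).colLen j = if j < ζ then N else 0 := by
  refine eq_of_forall_lt_iff fun i => ?_
  rw [← YoungDiagram.mem_iff_lt_colLen, mem_rect]
  split_ifs <;> simp [*]

theorem bCoeff_rect (t : F) (ζ N : ℕ) (hζ : 0 < ζ) :
    bCoeff (rect ζ N) 0 t = qPoch t t N := by
  obtain ⟨s, rfl⟩ : ∃ s, ζ = s + 1 := ⟨ζ - 1, by omega⟩
  have hden : ∏ c ∈ (rect (s + 1) N).cells,
      (1 - (0 : F) ^ (arm (rect (s + 1) N) c + 1) * t ^ leg (rect (s + 1) N) c) = 1 :=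
    Finset.prod_eq_one fun c _ => by simp
  rw [bCoeff, hden, div_one]
  change ∏ c ∈ range N ×ˢ range (s + 1), _ = _
  rw [Finset.prod_product, qPoch, ← Finset.prod_range_reflect (fun m => 1 - t ^ m * t)]
  refine Finset.prod_congr rfl fun a ha => ?_
  rw [mem_range] at ha
  rw [Finset.prod_range_succ, Finset.prod_eq_one fun b hb => ?_, one_mul]
  · simp only [arm, leg, rowLen_rect, colLen_rect, ha, if_true, Nat.sub_self, pow_zero, one_mul,
      Nat.lt_succ_self, ← pow_succ]
    rw [Nat.sub_sub, Nat.add_comm 1 a]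
  · rw [mem_range] at hb
    have : s - b ≠ 0 := by omega
    simp [arm, rowLen_rect, ha, this]

theorem prod_Icc_div_eq (t : F) (m : ℕ) :
    ∏ j ∈ Icc 1 m, (1 - t) / (1 - t ^ j) = (1 - t) ^ m / qPoch t t m := by
  induction m with
  | zero => simp [qPoch]
  | succ m ih => rw [Finset.prod_Icc_succ_top (by omega), ih, qPoch_succ, div_mul_div_comm,
      ← pow_succ, ← pow_succ]

theorem prod_mult_rect (t : F) (ζ N n : ℕ) (hζ : 0 < ζ) (hn : N ≤ n) :
    ∏ i ∈ range ((rect ζ N).rowLen 0 + 1), ∏ j ∈ Icc 1 (mult (rect ζ N) n i),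
      (1 - t) / (1 - t ^ j) = (1 - t) ^ n / (qPoch t t N * qPoch t t (n - N)) := by
  have hlt : mult (rect ζ N) n ζ = N := by
    have : (range n).filter (fun a => (rect ζ N).rowLen a = ζ) = range N := by
      ext a
      rw [mem_filter, rowLen_rect, mem_range, mem_range]
      split_ifs with h <;> simp [h, hζ.ne]; omega
    rw [mult, this, card_range]
  have hge : mult (rect ζ N) n 0 = n - N := by
    have : (range n).filter (fun a => (rect ζ N).rowLen a = 0) = range n \ range N := by
      ext a
      rw [mem_filter, rowLen_rect, mem_sdiff, mem_range, mem_range]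
      split_ifs with h <;> simp [h, hζ.ne']
    rw [mult, this, card_sdiff_of_subset (range_subset_range.2 hn), card_range, card_range]
  have hother (i : ℕ) (h0 : i ≠ 0) (h1 : i ≠ ζ) : mult (rect ζ N) n i = 0 := by
    rw [mult, card_eq_zero, filter_eq_empty_iff]
    intro a _
    rw [rowLen_rect]
    split_ifs
    · exact h1.symm
    · exact h0.symm
  rw [rowLen_rect]
  split_ifs with hN
  · rw [prod_range_succ, hlt, prod_range_eq_mul_Ico _ hζ, hge, Finset.prod_eq_one (s := Ico 1 ζ) fun i hi => ?_,
      mul_one, prod_Icc_div_eq, prod_Icc_div_eq, div_mul_div_comm, ← pow_add, Nat.sub_add_cancel hn,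
      mul_comm (qPoch t t N)]
    rw [mem_Ico] at hi
    rw [hother i (by omega) (by omega)]
    simp
  · obtain rfl : N = 0 := by omega
    rw [zero_add, prod_range_one, hge, prod_Icc_div_eq]
    simp [qPoch]

end Rectangle

section RationalFunctions

variable {F : Type*} [Field F] {n : ℕ}

theorem const_eq_algebraMap (c : F) : const n c = algebraMap F (RatFun F n) c := by
  rw [IsScalarTower.algebraMap_apply F (MvPolynomial (Fin n) F) (RatFun F n), algebraMap_eq, const]

theorem xvar_injective : Function.Injective (xvar : Fin n → RatFun F n) :=
  (IsFractionRing.injective (MvPolynomial (Fin n) F) (RatFun F n)).comp (X_injective)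

theorem xvar_ne_zero (i : Fin n) : (xvar i : RatFun F n) ≠ 0 := by
  rw [xvar, Ne, IsFractionRing.to_map_eq_zero_iff]
  exact X_ne_zero i

theorem algebraMap_toVars (f : SymFun F) :
    algebraMap (MvPolynomial (Fin n) F) (RatFun F n) (toVars n f) =
      aeval (fun m : ℕ+ => ∑ i, (xvar i : RatFun F n) ^ (m : ℕ)) f := by
  have : (IsScalarTower.toAlgHom F (MvPolynomial (Fin n) F) (RatFun F n)).comp (toVars n) =
      aeval (fun m : ℕ+ => ∑ i, (xvar i : RatFun F n) ^ (m : ℕ)) := by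
    ext m
    simp [toVars, psum, xvar]
  rw [← this]
  rfl

theorem qPoch_self_ne_zero (t : F) (ht : ∀ m : ℕ, 0 < m → t ^ m ≠ 1) (m : ℕ) :
    qPoch t t m ≠ 0 := by
  refine Finset.prod_ne_zero_iff.2 fun k _ h => ht (k + 1) k.succ_pos ?_
  rw [pow_succ]
  exact (sub_eq_zero.1 h).symm

theorem map_qPoch {R S : Type*} [CommRing R] [CommRing S] (φ : R →+* S) (a q : R) (m : ℕ) :
    φ (qPoch a q m) = qPoch (φ a) (φ q) m := by
  simp [qPoch]

theorem hallLittlewoodQ_rect (t : F) (ht : ∀ m : ℕ, 0 < m → t ^ m ≠ 1) (ζ N : ℕ) (hζ : 0 < ζ)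
    (hn : N ≤ n) :
    hallLittlewoodQ n (rect ζ N) t =
      (qPoch (algebraMap F (RatFun F n) t) (algebraMap F (RatFun F n) t) (n - N))⁻¹ *
        ((1 - algebraMap F (RatFun F n) t) ^ n * symmSum (algebraMap F (RatFun F n) t)
          (fun i => if (i : ℕ) < N then ζ else 0) xvar) := by
  rw [hallLittlewoodQ, hallLittlewoodP, bCoeff_rect t ζ N hζ, prod_mult_rect t ζ N n hζ hn,
    symmSum]
  simp only [const_eq_algebraMap, rowLen_rect]
  rw [← mul_assoc, ← mul_assoc, ← map_mul, ← map_qPoch, ← map_inv₀, ← map_one (algebraMap F (RatFun F n)),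
    ← map_sub, ← map_pow, ← map_mul]
  congr 2
  have h1 := qPoch_self_ne_zero t ht N
  have h2 := qPoch_self_ne_zero t ht (n - N)
  field_simp

variable [CharZero F]

theorem isHallLittlewoodQ_vertexOp (t : F) (ht : ∀ m : ℕ, 0 < m → t ^ m ≠ 1) (ζ N : ℕ)
    (hζ : 0 < ζ) : IsHallLittlewoodQ (rect ζ N) t ((vertexOp t ζ)^[N] 1) := by
  intro n hn
  rw [colLen_rect, if_pos hζ] at hn
  rw [hallLittlewoodQ_rect t ht ζ N hζ hn, algebraMap_toVars,
    ← aeval_vertexOp_iterate t ζ hζ N hn xvar xvar_injective xvar_ne_zero, ← map_qPoch,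
    inv_mul_cancel_left₀ ((map_ne_zero _).2 (qPoch_self_ne_zero t ht _))]

theorem IsHallLittlewoodQ.unique {μ : YoungDiagram} {t : F} {f g : SymFun F}
    (hf : IsHallLittlewoodQ μ t f) (hg : IsHallLittlewoodQ μ t g) : f = g :=
  eq_of_toVars_eq (μ.colLen 0) f g fun n hn =>
    IsFractionRing.injective (MvPolynomial (Fin n) F) (RatFun F n) ((hf n hn).trans (hg n hn).symm)

theorem hallLittlewoodSymQ_rect (t : F) (ht : ∀ m : ℕ, 0 < m → t ^ m ≠ 1) (ζ N : ℕ)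
    (hζ : 0 < ζ) : hallLittlewoodSymQ (rect ζ N) t = (vertexOp t ζ)^[N] 1 :=
  (Classical.epsilon_spec ⟨_, isHallLittlewoodQ_vertexOp t ht ζ N hζ⟩ :
    IsHallLittlewoodQ (rect ζ N) t (hallLittlewoodSymQ (rect ζ N) t)).unique
      (isHallLittlewoodQ_vertexOp t ht ζ N hζ)

end RationalFunctions

section RaisingOperator

variable {F : Type*} [Field F] {p : ℕ}

theorem shift_xvar (z : Fˣ) (I : Finset (Fin p)) (j : Fin p) :
    shift z I (xvar j) = if j ∈ I then const p (z : F) * xvar j else xvar j := by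
  rw [shift, xvar, IsFractionRing.ringEquivOfRingEquiv_algebraMap]
  change algebraMap _ _ (shiftPoly z I (X j)) = _
  rw [shiftPoly]
  rw [AlgEquiv.ofAlgHom_apply, aeval_X]
  split_ifs
  · rw [map_mul, const]
  · rfl

theorem shift_algebraMap (z : Fˣ) (I : Finset (Fin p)) (c : F) :
    shift z I (algebraMap F (RatFun F p) c) = algebraMap F (RatFun F p) c := by
  rw [IsScalarTower.algebraMap_apply F (MvPolynomial (Fin p) F) (RatFun F p), shift,
    IsFractionRing.ringEquivOfRingEquiv_algebraMap]
  congr 1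
  exact (shiftPoly z I).commutes c

theorem raisingOp_one (z : Fˣ) (ζ : ℕ) (f : RatFun F p) :
    raisingOp z 1 ζ f = ∑ i, xvar i ^ ζ *
      (∏ j ∈ ({i} : Finset (Fin p))ᶜ, (1 - xvar j / xvar i)⁻¹) * shift z {i} f := by
  rw [raisingOp, Finset.powersetCard_one, Finset.sum_map]
  simp

theorem algebraMap_toVars_plethysm_vertexOp [CharZero F] (z : Fˣ)
    (hz : ∀ m : ℕ, 0 < m → (z : F) ^ m ≠ 1) (ζ : ℕ) (hζ : 0 < ζ) (f : SymFun F) :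
    algebraMap (MvPolynomial (Fin p) F) (RatFun F p)
        (toVars p (plethysm (z : F) (vertexOp (z : F) ζ f))) =
      raisingOp z 1 ζ (algebraMap (MvPolynomial (Fin p) F) (RatFun F p)
        (toVars p (plethysm (z : F) f))) := by
  let ε : SymFun F →ₐ[F] RatFun F p :=
    (aeval (fun m : ℕ+ => ∑ i, (xvar i : RatFun F p) ^ (m : ℕ))).comp (plethysm (z : F))
  have hX (m : ℕ+) : ε (X m) = algebraMap F (RatFun F p) (1 - (z : F) ^ (m : ℕ))⁻¹ *
      ∑ i, (xvar i : RatFun F p) ^ (m : ℕ) := by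
    simp only [ε, AlgHom.comp_apply, plethysm, aeval_X, map_mul, aeval_C]
  have hne (m : ℕ+) : algebraMap F (RatFun F p) (1 - (z : F) ^ (m : ℕ)) ≠ 0 :=
    (map_ne_zero _).2 fun h => hz m m.pos (sub_eq_zero.1 h).symm
  rw [algebraMap_toVars, algebraMap_toVars]
  change ε _ = raisingOp z 1 ζ (ε f)
  rw [map_vertexOp (z : F) ε xvar 0 xvar_injective xvar_ne_zero _ ζ hζ, raisingOp_one]
  · refine Finset.sum_congr rfl fun i _ => ?_
    have hw : weight (xvar : Fin p → RatFun F p) 0 i =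
        ∏ j ∈ ({i} : Finset (Fin p))ᶜ, (1 - xvar j / xvar i)⁻¹ := by
      simp [weight]
    have hs : ((aeval fun m : ℕ+ => ε (X m) - xvar i ^ (m : ℕ) : SymFun F →ₐ[F] RatFun F p) :
        SymFun F →+* RatFun F p) =
          (shift z {i} : RatFun F p →+* RatFun F p).comp (ε : SymFun F →+* RatFun F p) := by
      refine MvPolynomial.ringHom_ext (fun c => ?_) fun m => ?_
      · simp [← algebraMap_eq, shift_algebraMap]
      · have hshift : shift z {i} (∑ j, (xvar j : RatFun F p) ^ (m : ℕ)) =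
            ∑ j, xvar j ^ (m : ℕ) -
              algebraMap F (RatFun F p) (1 - (z : F) ^ (m : ℕ)) * xvar i ^ (m : ℕ) := by
          rw [map_sum, ← Finset.sum_add_sum_compl {i},
            ← Finset.sum_add_sum_compl {i} (fun j => (xvar j : RatFun F p) ^ (m : ℕ)),
            sum_singleton, sum_singleton, map_pow, shift_xvar, if_pos (mem_singleton_self i),
            Finset.sum_congr rfl fun j hj => ?_, const_eq_algebraMap, mul_pow, map_sub, map_one,
            map_pow]
          · ring
          · rw [map_pow, shift_xvar, if_neg (mem_compl.1 hj)]
        simp only [RingHom.coe_coe, aeval_X, RingHom.comp_apply]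
        rw [hX, map_mul, shift_algebraMap, hshift, map_inv₀, mul_sub,
          inv_mul_cancel_left₀ (hne m)]
    have := congrArg (fun g : SymFun F →+* RatFun F p => g f) hs
    simp only [RingHom.coe_coe, RingHom.comp_apply] at this
    rw [hw, this]
    ring
  · intro m
    rw [hX, map_inv₀, mul_inv_cancel_left₀ (hne m)]
    simp

theorem algebraMap_milne_rect [CharZero F] (z : Fˣ)
    (hz : ∀ m : ℕ, 0 < m → (z : F) ^ m ≠ 1) (ζ N : ℕ) (hζ : 0 < ζ) :
    algebraMap (MvPolynomial (Fin p) F) (RatFun F p) (milne p (rect ζ N) (z : F)) =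
      (raisingOp z 1 ζ)^[N] 1 := by
  rw [milne, hallLittlewoodSymQ_rect (z : F) hz ζ N hζ]
  induction N with
  | zero => simp
  | succ N ih => rw [Function.iterate_succ_apply', Function.iterate_succ_apply', ← ih,
      algebraMap_toVars_plethysm_vertexOp z hz ζ hζ]

end RaisingOperator

section EulerSum

variable {F : Type*} [Field F] {p : ℕ}

/-- The summand of `eulerSum` at `k`. -/
noncomputable def eulerTerm (z : F) (ζ : ℕ) (k : Fin p → ℕ) : RatFun F p :=
  (∏ i, (xvar i ^ k i * const p z ^ (k i * (k i - 1) / 2)) ^ ζ) *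
    ∏ i, ∏ j, (qPoch (const p z ^ ((k i : ℤ) - (k j : ℤ) + 1) * (xvar i / xvar j))
      (const p z) (k j))⁻¹

theorem const_unit_ne_zero (z : Fˣ) : const p (z : F) ≠ 0 := by
  rw [const_eq_algebraMap]
  exact (map_ne_zero _).2 z.ne_zero

theorem shift_const (z : Fˣ) (I : Finset (Fin p)) (c : F) : shift z I (const p c) = const p c := by
  rw [const_eq_algebraMap, shift_algebraMap]

theorem const_pow_mul_xvar_ne (z : F) (hz : ∀ m : ℕ, 0 < m → z ^ m ≠ 1) (m : ℕ)
    (a i : Fin p) (h : a = i → 0 < m) : const p z ^ m * xvar a ≠ (xvar i : RatFun F p) := by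
  rw [const, xvar, xvar, ← map_pow, ← map_mul, ← C_pow]
  intro heq
  have heq := congrArg (coeff (Finsupp.single i 1))
    (IsFractionRing.injective (MvPolynomial (Fin p) F) (RatFun F p) heq)
  simp only [coeff_C_mul, coeff_X, Finsupp.single_left_inj one_ne_zero] at heq
  split_ifs at heq with hai
  · exact hz m (h hai) (by simpa using heq)
  · simp at heq

theorem shift_const_pow_mul_xvar (z : Fˣ) (i a : Fin p) (k : Fin p → ℕ) :
    shift z {i} (const p (z : F) ^ k a * xvar a) =
      const p (z : F) ^ (k + Pi.single i 1 : Fin p → ℕ) a * xvar a := by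
  rw [map_mul, map_pow, shift_const, shift_xvar]
  obtain rfl | h := eq_or_ne a i
  · simp [pow_succ, mul_assoc]
  · simp [h]

theorem zpow_mul_div (z : Fˣ) (k : Fin p → ℕ) (a b : Fin p) :
    const p (z : F) ^ ((k a : ℤ) - (k b : ℤ) + 1) * (xvar a / xvar b) =
      const p (z : F) * ((const p (z : F) ^ k a * xvar a) / (const p (z : F) ^ k b * xvar b)) := by
  have hc := const_unit_ne_zero (p := p) z
  rw [zpow_add₀ hc, zpow_sub₀ hc, zpow_natCast, zpow_natCast, zpow_one, mul_div_mul_comm]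
  ring

theorem shift_inv_qPoch (z : Fˣ) (hz : ∀ m : ℕ, 0 < m → (z : F) ^ m ≠ 1) (i a b : Fin p)
    (k k' : Fin p → ℕ) (hk : k' = k + Pi.single i 1) :
    shift z {i} (qPoch (const p (z : F) ^ ((k a : ℤ) - (k b : ℤ) + 1) * (xvar a / xvar b))
        (const p (z : F)) (k b))⁻¹ =
      (qPoch (const p (z : F) ^ ((k' a : ℤ) - (k' b : ℤ) + 1) * (xvar a / xvar b))
        (const p (z : F)) (k' b))⁻¹ *
          if b = i then 1 - (const p (z : F) ^ k' a * xvar a) / xvar i else 1 := by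
  have hc := const_unit_ne_zero (p := p) z
  rw [map_inv₀, ← RingEquiv.coe_toRingHom, map_qPoch, RingEquiv.coe_toRingHom, zpow_mul_div,
    zpow_mul_div, map_mul, map_div₀, shift_const_pow_mul_xvar, shift_const_pow_mul_xvar,
    shift_const, ← hk]
  split_ifs with hb
  · subst hb
    have hkb : k' b = k b + 1 := by simp [hk]
    have hlast : const p (z : F) ^ k b * (const p (z : F) * ((const p (z : F) ^ k' a * xvar a) /
        (const p (z : F) ^ k' b * xvar b))) = (const p (z : F) ^ k' a * xvar a) / xvar b := by
      have := xvar_ne_zero (F := F) b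
      rw [hkb]
      field_simp
      ring
    have hne : 1 - (const p (z : F) ^ k' a * xvar a) / xvar b ≠ 0 := by
      intro h
      refine const_pow_mul_xvar_ne (z : F) hz (k' a) a b (fun hab => by rw [hab, hkb]; omega) ?_
      exact (div_eq_one_iff_eq (xvar_ne_zero b)).1 (sub_eq_zero.1 h).symm
    rw [hkb, qPoch_succ, ← hkb, hlast, mul_inv, inv_mul_cancel_right₀ hne]
  · have hkb : k' b = k b := by simp [hk, hb]
    rw [hkb, mul_one]

theorem xvar_pow_mul_shift_eulerTerm (z : Fˣ) (hz : ∀ m : ℕ, 0 < m → (z : F) ^ m ≠ 1) (ζ : ℕ)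
    (i : Fin p) (k k' : Fin p → ℕ) (hk : k' = k + Pi.single i 1) :
    xvar i ^ ζ * (∏ j ∈ ({i} : Finset (Fin p))ᶜ, (1 - xvar j / xvar i)⁻¹) *
        shift z {i} (eulerTerm (z : F) ζ k) =
      weight xvar (fun j => const p (z : F) ^ k' j * xvar j) i * eulerTerm (z : F) ζ k' := by
  have hpow : xvar i ^ ζ * shift z {i}
      (∏ j, (xvar j ^ k j * const p (z : F) ^ (k j * (k j - 1) / 2)) ^ ζ) =
        ∏ j, (xvar j ^ k' j * const p (z : F) ^ (k' j * (k' j - 1) / 2)) ^ ζ := by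
    rw [map_prod, ← Finset.prod_mul_prod_compl {i}, ← Finset.prod_mul_prod_compl {i}
      (fun j => (xvar j ^ k' j * const p (z : F) ^ (k' j * (k' j - 1) / 2)) ^ ζ), ← mul_assoc,
      prod_singleton, prod_singleton]
    congr 1
    · have hki : k' i = k i + 1 := by simp [hk]
      rw [hki, Nat.triangle_succ, map_pow, map_mul, map_pow, map_pow, shift_const, shift_xvar,
        if_pos (mem_singleton_self i), ← mul_pow]
      congr 1
      ring
    · refine Finset.prod_congr rfl fun j hj => ?_
      rw [mem_compl, mem_singleton] at hj
      have hkj : k' j = k j := by simp [hk, hj]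
      rw [hkj, map_pow, map_mul, map_pow, map_pow, shift_const, shift_xvar,
        if_neg (by simpa using hj)]
  rw [eulerTerm, eulerTerm, map_mul, ← hpow, map_prod]
  simp only [map_prod, shift_inv_qPoch z hz i _ _ k k' hk, Finset.prod_mul_distrib,
    Finset.prod_ite_eq', mem_univ, if_true, weight]
  ring

theorem raisingOp_eulerSum (z : Fˣ) (hz : ∀ m : ℕ, 0 < m → (z : F) ^ m ≠ 1) (N ζ : ℕ) :
    raisingOp z 1 ζ (eulerSum (z : F) N p ζ) =
      (1 - const p (z : F) ^ (N + 1)) * eulerSum (z : F) (N + 1) p ζ := by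
  have hsum (M : ℕ) : eulerSum (z : F) M p ζ =
      ∑ k ∈ piAntidiag univ M, eulerTerm (z : F) ζ k := rfl
  have hstep (i : Fin p) : xvar i ^ ζ * (∏ j ∈ ({i} : Finset (Fin p))ᶜ,
      (1 - xvar j / xvar i)⁻¹) * shift z {i} (eulerSum (z : F) N p ζ) =
        ∑ k ∈ piAntidiag univ (N + 1),
          weight xvar (fun j => const p (z : F) ^ k j * xvar j) i * eulerTerm (z : F) ζ k := by
    rw [hsum, map_sum, Finset.mul_sum]
    refine Finset.sum_of_injOn (fun k => k + Pi.single i 1) (fun k _ l _ h => ?_)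
      (fun k hk => ?_) (fun k hk hk' => ?_)
      fun k _ => xvar_pow_mul_shift_eulerTerm z hz ζ i k _ rfl
    · exact add_right_cancel h
    · simp only [mem_coe, mem_piAntidiag, mem_univ, implies_true, and_true] at hk ⊢
      simp [Finset.sum_add_distrib, hk]
    · have hki : k i = 0 := by
        by_contra hki
        refine hk' ⟨k - Pi.single i 1, ?_, ?_⟩
        · simp only [mem_coe, mem_piAntidiag, mem_univ, implies_true, and_true] at hk ⊢
          have h1 : (k - Pi.single i 1) + Pi.single i 1 = k := by
            ext j
            obtain rfl | h := eq_or_ne j i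
            · simp
              omega
            · simp [h]
          have h2 : univ.sum (k - Pi.single i 1 : Fin p → ℕ) + 1 = univ.sum k := by
            conv_rhs => rw [← h1]
            simp [Finset.sum_add_distrib]
          omega
        · ext j
          obtain rfl | h := eq_or_ne j i
          · simp
            omega
          · simp [h]
      rw [weight, Finset.prod_eq_zero (mem_univ i) (by simp [hki, xvar_ne_zero]), zero_mul,
        zero_mul]
  rw [raisingOp_one, Finset.sum_congr rfl fun i _ => hstep i, Finset.sum_comm, hsum,
    Finset.mul_sum]
  refine Finset.sum_congr rfl fun k hk => ?_
  rw [mem_piAntidiag] at hk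
  rw [← Finset.sum_mul, sum_weight _ _ xvar_injective xvar_ne_zero]
  rw [Finset.prod_congr rfl fun j _ => mul_div_cancel_right₀ (_ : RatFun F p) (xvar_ne_zero (F := F) j),
    Finset.prod_pow_eq_pow_sum, hk.1]

theorem raisingOp_const_mul (z : Fˣ) (α n : ℕ) (c : F) (f : RatFun F p) :
    raisingOp z α n (const p c * f) = const p c * raisingOp z α n f := by
  rw [raisingOp, raisingOp, Finset.mul_sum]
  refine Finset.sum_congr rfl fun I _ => ?_
  rw [map_mul, shift_const]
  ring

theorem raisingOp_iterate_one (z : Fˣ) (hz : ∀ m : ℕ, 0 < m → (z : F) ^ m ≠ 1) (N ζ : ℕ) :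
    (raisingOp z 1 ζ)^[N] 1 =
      const p (qPoch (z : F) z N) * eulerSum (z : F) N p ζ := by
  induction N with
  | zero => simp [eulerSum, qPoch, const]
  | succ N ih =>
    rw [Function.iterate_succ_apply', ih, raisingOp_const_mul, raisingOp_eulerSum z hz,
      qPoch_succ, ← pow_succ]
    simp only [const_eq_algebraMap, map_mul, map_sub, map_one, map_pow]
    ring

end EulerSum

end HananyTong

theorem mainTheorem2 {F : Type*} [Field F] [CharZero F] (z : Fˣ)
    (hz : ∀ n : ℕ, 0 < n → (z : F) ^ n ≠ 1) (N p ζ : ℕ) (hζ : 0 < ζ) :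
    HananyTong.eulerSum (z : F) N p ζ =
        (HananyTong.const p (HananyTong.qPoch (z : F) z N))⁻¹ *
          (HananyTong.raisingOp z 1 ζ)^[N] 1 ∧
      (∃! f : HananyTong.SymFun F,
        HananyTong.IsHallLittlewoodQ (HananyTong.rect ζ N) (z : F) f) ∧
      HananyTong.eulerSum (z : F) N p ζ =
        (HananyTong.const p (HananyTong.qPoch (z : F) z N))⁻¹ *
          algebraMap (MvPolynomial (Fin p) F) (HananyTong.RatFun F p)
            (HananyTong.milne p (HananyTong.rect ζ N) (z : F)) ∧
      ∃ g : MvPolynomial (Fin p) F,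
        HananyTong.eulerSum (z : F) N p ζ =
          algebraMap (MvPolynomial (Fin p) F) (HananyTong.RatFun F p) g := by

  have hne : HananyTong.const p (HananyTong.qPoch (z : F) z N) ≠ 0 := by
    rw [HananyTong.const_eq_algebraMap]
    exact (map_ne_zero _).2 (HananyTong.qPoch_self_ne_zero (z : F) hz N)
  have hD : HananyTong.eulerSum (z : F) N p ζ =
      (HananyTong.const p (HananyTong.qPoch (z : F) z N))⁻¹ *
        (HananyTong.raisingOp z 1 ζ)^[N] 1 := by
    rw [HananyTong.raisingOp_iterate_one z hz, inv_mul_cancel_left₀ hne]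
  have hM := hD
  rw [← HananyTong.algebraMap_milne_rect z hz ζ N hζ] at hM
  refine ⟨hD, ⟨_, HananyTong.isHallLittlewoodQ_vertexOp (z : F) hz ζ N hζ, fun f hf =>
    hf.unique (HananyTong.isHallLittlewoodQ_vertexOp (z : F) hz ζ N hζ)⟩, hM,
    C (HananyTong.qPoch (z : F) z N)⁻¹ * HananyTong.milne p (HananyTong.rect ζ N) (z : F), ?_⟩
  rw [hM, map_mul]
  congr 1
  change _ = HananyTong.const p _
  rw [HananyTong.const_eq_algebraMap, HananyTong.const_eq_algebraMap, map_inv₀]
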